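/- **Definitions.** For a unital ring $A$ let $Lg_n(A)$ be the set of $n$-tuples $(a_1,\dots,a_n)\in A^n$ with $Aa_1+\cdots+Aa_n=A$. The Bass stable rank $Bsr(A)$ is the smallest integer $n\ge 1$ such that for every $(a_1,\dots,a_{n+1})\in Lg_{n+1}(A)$ there is $(c_1,\dots,c_n)\in A^n$ with $(a_1+c_1a_{n+1},\dots,a_n+c_na_{n+1})\in Lg_n(A)$; if there is no such $n$, then $Bsr(A)=\infty$. A unital Fréchet $Q$-algebra is a unital complex algebra which is a (complete, metrizable, locally convex) Fréchet space, with jointly continuous multiplication and open set of invertible elements. A $*$-morphism is a unital $*$-homomorphism of complex $*$-algebras. A morphism $f:A\to B$ is dense if $f(A)$ is dense in $B$, and full if $a\in A$ is invertible in $A$ whenever $f(a)$ is invertible in $B$; a unital $*$-subalgebra is dense, respectively full, if its inclusion map is. Let $B$ be a unital $C^*$-algebra with unit $e$. A dense $*$-subalgebra $C\ni e$ of a commutative unital Banach $*$-algebra $D$ is normal in $D$ if for all disjoint closed subsets $T_1,T_2$ of the maximal ideal space of $D$ there is $y\in C$ whose Gelfand transform is $0$ on $T_1$ and $1$ on $T_2$.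 A dense $*$-subalgebra $C\ni e$ of $B$ is locally normal in $B$ if every self-adjoint $x\in C$ is contained in a commutative closed $*$-subalgebra $D(x)\ni e$ of $B$ such that $D(x)\cap C$ is a dense normal subalgebra of $D(x)$. **Theorem 4.9.** (i) Let $A$ be a unital Fréchet $Q$-algebra which is a $*$-algebra, let $B$ be a unital $C^*$-algebra, and let $f:A\to B$ be a dense and full $*$-morphism such that $f(A)$ is locally normal in $B$. Then $Bsr(A)=Bsr(B)$. (ii) In particular, let $A$ be a dense and full unital $*$-subalgebra of a unital $C^*$-algebra $B$ which is a Fréchet $Q$-algebra in some topology of its own, and which is closed under the $C^\infty$-functional calculus of self-adjoint elements: $g(a)\in A$ for every self-adjoint $a\in A$ and every $C^\infty$ function $g$ on $\mathbb R$. Then $Bsr(A)=Bsr(B)$. -/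

import Mathlib

open scoped ContDiff

/-- The `n`-tuple `a` generates `A` as a left ideal: `A a₁ + ⋯ + A aₙ = A`, that is,
`a ∈ Lg_n(A)`.  (An `Ideal` of a possibly noncommutative ring is a left ideal.) -/
def IsLeftGenerating {A : Type*} [Ring A] {n : ℕ} (a : Fin n → A) : Prop :=
  Ideal.span (Set.range a) = ⊤

/-- Bass' stable range condition `(Bsr)_n`: for every `(a₁, …, aₙ₊₁) ∈ Lg_{n+1}(A)` there is
`(c₁, …, cₙ) ∈ Aⁿ` with `(a₁ + c₁ aₙ₊₁, …, aₙ + cₙ aₙ₊₁) ∈ Lg_n(A)`. -/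
def BassCondition (A : Type*) [Ring A] (n : ℕ) : Prop :=
  ∀ a : Fin (n + 1) → A, IsLeftGenerating a →
    ∃ c : Fin n → A, IsLeftGenerating fun i : Fin n => a i.castSucc + c i * a (Fin.last n)

/-- The Bass stable rank: the smallest positive integer `n` such that `(Bsr)_n` holds, and `∞`
if there is none (the infimum of the empty set in `ℕ∞` is `⊤`). -/
noncomputable def Bsr (A : Type*) [Ring A] : ℕ∞ :=
  ⨅ (n : ℕ) (_ : 1 ≤ n ∧ BassCondition A n), (n : ℕ∞)

/-- `A` with the topology `t` is a unital Fréchet `Q`-algebra: a complex Fréchet space (a complete,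
metrizable, locally convex topological vector space) with jointly continuous multiplication, whose
set of invertible elements is open.  The topology is an explicit argument because a subalgebra of a
normed algebra will be considered with a topology of its own. -/
structure IsFrechetQAlgebra (A : Type*) [Ring A] [Algebra ℂ A] (t : TopologicalSpace A) :
    Prop where
  isTopologicalAddGroup : IsTopologicalAddGroup A
  continuousSMul : ContinuousSMul ℂ A
  locallyConvexSpace : LocallyConvexSpace ℝ A
  metrizableSpace : TopologicalSpace.MetrizableSpace A
  completeSpace : @CompleteSpace A (IsTopologicalAddGroup.rightUniformSpace A)
  continuousMul : ContinuousMul A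
  isOpen_isUnit : IsOpen {a : A | IsUnit a}

section LocallyNormal

variable {D : Type*} [Ring D] [StarRing D] [Algebra ℂ D] [StarModule ℂ D] [TopologicalSpace D]

/-- A `*`-subalgebra `C` of (a commutative unital Banach `*`-algebra) `D` is normal if the functions
`φ ↦ φ y`, `y ∈ C`, separate disjoint closed subsets of the maximal ideal space of `D`,
here realized as the space of characters of `D` with the Gelfand (weak-*) topology. -/
def IsNormalSubalgebra (C : StarSubalgebra ℂ D) : Prop :=
  ∀ T₁ T₂ : Set (WeakDual.characterSpace ℂ D), IsClosed T₁ → IsClosed T₂ → Disjoint T₁ T₂ →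
    ∃ y ∈ C, (∀ φ ∈ T₁, φ y = 0) ∧ (∀ φ ∈ T₂, φ y = 1)

/-- A `*`-subalgebra `C` of `D` is locally normal in `D` if every self-adjoint `x ∈ C` lies in a
commutative closed unital `*`-subalgebra `E` of `D` such that `E ∩ C`, viewed as a subalgebra of
`E`, is dense and normal in `E`. -/
def IsLocallyNormal (C : StarSubalgebra ℂ D) : Prop :=
  ∀ x ∈ C, IsSelfAdjoint x →
    ∃ E : StarSubalgebra ℂ D, x ∈ E ∧ IsClosed (E : Set D) ∧ (∀ a ∈ E, ∀ b ∈ E, a * b = b * a) ∧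
      Dense (C.comap E.subtype : Set E) ∧ IsNormalSubalgebra (C.comap E.subtype)

end LocallyNormal

/-- `S` is closed under the `C^∞`-functional calculus of self-adjoint elements: `g(a) ∈ S` for each
self-adjoint `a ∈ S` and each `C^∞` function `g` on the real line.  Real-valued `g` suffice, since
`S` is a complex subspace. -/
def IsClosedUnderSmoothCalculus {B : Type*} [CStarAlgebra B] (S : StarSubalgebra ℂ B) : Prop :=
  ∀ a ∈ S, IsSelfAdjoint a → ∀ g : ℝ → ℝ, ContDiff ℝ ∞ g → cfc g a ∈ S

/-! Openness of the units, density and fullness let tuples and coefficients be moved between `B` and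
`f(A)`, so Bass' condition descends from `B` to `A` (`BassCondition.of_denseRange`). For the
converse, Bass' condition on `A` makes left generating `n`-tuples dense in `Bⁿ`
(`dense_isLeftGenerating`), and density implies the condition on `B` (`bassCondition_of_dense`). The
density argument only needs cut-offs of `∑ aᵢ⋆ aᵢ` lying in `f(A)`; smooth calculus and local
normality are two ways to produce them. -/

open Topology

/-! ### Generating tuples in a ring. -/

section Algebraic

variable {A : Type*} [Ring A] {n : ℕ}

theorem isLeftGenerating_iff_exists {a : Fin n → A} :
    IsLeftGenerating a ↔ ∃ d : Fin n → A, ∑ i, d i * a i = 1 := by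
  rw [IsLeftGenerating, Ideal.eq_top_iff_one, Ideal.span, Submodule.mem_span_range_iff_exists_fun]
  rfl

theorem isLeftGenerating_of_isUnit {a d : Fin n → A} (h : IsUnit (∑ i, d i * a i)) :
    IsLeftGenerating a := by
  obtain ⟨u, hu⟩ := h
  refine isLeftGenerating_iff_exists.2 ⟨fun i => ↑u⁻¹ * d i, ?_⟩
  simp only [mul_assoc, ← Finset.mul_sum, ← hu, Units.inv_mul]

theorem IsLeftGenerating.map {B F : Type*} [Ring B] [FunLike F A B] [RingHomClass F A B]
    (f : F) {a : Fin n → A} (h : IsLeftGenerating a) : IsLeftGenerating fun i => f (a i) := by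
  obtain ⟨d, hd⟩ := isLeftGenerating_iff_exists.1 h
  refine isLeftGenerating_iff_exists.2 ⟨fun i => f (d i), ?_⟩
  simp only [← map_mul, ← map_sum, hd, map_one]

theorem IsLeftGenerating.mul_isUnit {a : Fin n → A} (h : IsLeftGenerating a) {u : A}
    (hu : IsUnit u) : IsLeftGenerating fun i => a i * u := by
  obtain ⟨d, hd⟩ := isLeftGenerating_iff_exists.1 h
  refine isLeftGenerating_of_isUnit (d := d) ?_
  simpa only [← mul_assoc, ← Finset.sum_mul, hd, one_mul]

theorem bsr_congr {B : Type*} [Ring B] (h : ∀ n, BassCondition A n ↔ BassCondition B n) :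
    Bsr A = Bsr B := by
  simp only [Bsr, h]

end Algebraic

/-! ### Transfer along dense full morphisms. -/

section Topological

variable {B : Type*} [NormedRing B] [CompleteSpace B] {n : ℕ}

theorem isOpen_setOf_isLeftGenerating : IsOpen {b : Fin n → B | IsLeftGenerating b} := by
  rw [isOpen_iff_forall_mem_open]
  intro b hb
  obtain ⟨d, hd⟩ := isLeftGenerating_iff_exists.1 hb
  refine ⟨{b | IsUnit (∑ i, d i * b i)}, fun _ => isLeftGenerating_of_isUnit,
    Units.isOpen.preimage (by fun_prop), ?_⟩
  simp [hd]

/-- Perturbing the coefficients into the range of `f` keeps the sum invertible in `B`; fullness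
makes its preimage invertible in `A`. -/
theorem IsLeftGenerating.of_map {A F : Type*} [Ring A] [FunLike F A B] [RingHomClass F A B]
    {f : F} (hd : DenseRange f) (hf : ∀ a, IsUnit (f a) → IsUnit a) {a : Fin n → A}
    (h : IsLeftGenerating fun i => f (a i)) : IsLeftGenerating a := by
  obtain ⟨d, hd1⟩ := isLeftGenerating_iff_exists.1 h
  have hdense : DenseRange (Pi.map fun _ : Fin n => (f : A → B)) := DenseRange.piMap fun _ => hd
  obtain ⟨d', hd'⟩ := hdense.exists_mem_open
    (s := {d : Fin n → B | IsUnit (∑ i, d i * f (a i))})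
    (Units.isOpen.preimage (by fun_prop)) ⟨d, by simp [hd1]⟩
  refine isLeftGenerating_of_isUnit (d := d') (hf _ ?_)
  simpa only [map_sum, map_mul] using! hd'

theorem BassCondition.of_denseRange {A F : Type*} [Ring A] [FunLike F A B] [RingHomClass F A B]
    {f : F} (hd : DenseRange f) (hf : ∀ a, IsUnit (f a) → IsUnit a) (h : BassCondition B n) :
    BassCondition A n := by
  intro a ha
  obtain ⟨c, hc⟩ := h _ (ha.map f)
  have hdense : DenseRange (Pi.map fun _ : Fin n => (f : A → B)) := DenseRange.piMap fun _ => hd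
  obtain ⟨c', hc'⟩ := hdense.exists_mem_open
    ((isOpen_setOf_isLeftGenerating (n := n)).preimage
      (f := fun c : Fin n → B => fun i => f (a i.castSucc) + c i * f (a (Fin.last n)))
      (by fun_prop)) ⟨c, hc⟩
  refine ⟨c', IsLeftGenerating.of_map hd hf ?_⟩
  simpa only [map_add, map_mul] using! hc'

/-- If the left generating tuples are dense, so are the right generating ones, and these can be
used to correct the coefficients in `∑ dᵢ aᵢ + d aₙ₊₁ = 1`. -/
theorem bassCondition_of_dense [StarRing B] [ContinuousStar B]
    (h : Dense {b : Fin n → B | IsLeftGenerating b}) : BassCondition B n := by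
  intro a ha
  obtain ⟨d, hd⟩ := isLeftGenerating_iff_exists.1 ha
  rw [Fin.sum_univ_castSucc] at hd
  obtain ⟨b, hb, hbg⟩ := h.inter_open_nonempty
    {b : Fin n → B | IsUnit (∑ i, star (b i) * a i.castSucc + d (Fin.last n) * a (Fin.last n))}
    (Units.isOpen.preimage (by fun_prop)) ⟨fun i => star (d i.castSucc), by simp [hd]⟩
  obtain ⟨e, he⟩ := isLeftGenerating_iff_exists.1 hbg
  have he' : ∑ i, star (b i) * star (e i) = 1 := by
    simpa [star_sum] using congrArg star he
  -- With `∑ bᵢ⋆ eᵢ⋆ = 1`, multiplying the corrected tuple by the `bᵢ⋆` gives back the unit `∑ bᵢ⋆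
  -- aᵢ + d aₙ₊₁`.
  refine ⟨fun i => star (e i) * d (Fin.last n),
    isLeftGenerating_of_isUnit (d := fun i => star (b i)) ?_⟩
  simpa only [mul_add, Finset.sum_add_distrib, ← mul_assoc, ← Finset.sum_mul, he', one_mul] using! hb

end Topological

/-! ### Density of generating tuples from spectral cut-offs. -/

section CStar

theorem exists_character_real {E : Type*} [CommCStarAlgebra E] {x : E} (hx : IsSelfAdjoint x)
    (φ : WeakDual.characterSpace ℂ E) : ∃ r : ℝ, φ x = r ∧ r ∈ spectrum ℝ x ∧
      ∀ k : ℝ → ℝ, Continuous k → φ (cfc k x) = k r := by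
  have h : IsSelfAdjoint (φ x) := hx.map φ
  obtain ⟨r, hr⟩ := Complex.conj_eq_iff_real.1 h.star_eq
  refine ⟨r, hr, ?_, fun k hk => ?_⟩
  · rw [← spectrum.algebraMap_mem_iff ℂ, Complex.coe_algebraMap, ← hr]
    exact AlgHom.apply_mem_spectrum φ x
  · rw [StarAlgHomClass.map_cfc φ k x, hr]
    exact cfc_algebraMap r k

variable {B : Type*} [CStarAlgebra B] [PartialOrder B] [StarOrderedRing B]

/-- The spectral cut-off property of a subset `C` of a C⋆-algebra: for each positive `x ∈ C` and
each `δ > 0` there are `y ∈ C`, nonvanishing where `x` is small, and a positive `k` of the ambient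
algebra, orthogonal to `y`, which is close to `1` with respect to `x`. -/
def HasSpectralCutoffs (C : Set B) : Prop :=
  ∀ x ∈ C, 0 ≤ x → ∀ δ : ℝ, 0 < δ →
    ∃ y ∈ C, IsUnit (x + star y * y) ∧
      ∃ k : B, 0 ≤ k ∧ y * k = 0 ∧ ‖(1 - k) * x * (1 - k)‖ ≤ δ

theorem isUnit_smul_one_add_smul {k : B} (hk : 0 ≤ k) {ε : ℝ} (h0 : 0 < ε) (h1 : ε ≤ 1) :
    IsUnit (ε • (1 : B) + (1 - ε) • k) := by
  have : IsStrictlyPositive (ε • (1 : B) + (1 - ε) • k) :=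
    (IsStrictlyPositive.smul h0 isStrictlyPositive_one).add_nonneg
      (smul_nonneg (by linarith) hk)
  exact this.isUnit

/-- The left generating tuples are dense: if `bᵢ = f aᵢ` and `y = f w` is a cut-off of
`x = ∑ aᵢ⋆ aᵢ`, then `(a, w)` is left generating, which gives `c` with `a + c w` left generating,
and `(f a + f c y) u` approximates `f a` for a suitable invertible `u`. -/
theorem dense_isLeftGenerating {A : Type*} [Ring A] [StarRing A] [Algebra ℂ A]
    {f : A →⋆ₐ[ℂ] B} (hd : DenseRange f) (hf : ∀ a, IsUnit (f a) → IsUnit a)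
    (hs : HasSpectralCutoffs (Set.range f)) {n : ℕ} (hA : BassCondition A n) :
    Dense {b : Fin n → B | IsLeftGenerating b} := by
  have hdense : DenseRange (Pi.map fun _ : Fin n => (f : A → B)) := DenseRange.piMap fun _ => hd
  rw [← dense_closure]
  refine hdense.mono ?_
  rintro _ ⟨a, rfl⟩
  rw [Metric.mem_closure_iff]
  intro η hη
  set x : A := ∑ i, star (a i) * a i with hx
  have hx0 : f x = ∑ i, star (f (a i)) * f (a i) := by
    simp [hx, map_star]
  obtain ⟨_, ⟨w, rfl⟩, hw, k, hk, hyk, hxk⟩ := hs (f x) ⟨x, rfl⟩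
    (hx0 ▸ Finset.sum_nonneg fun i _ => star_mul_self_nonneg _) ((η / 2) ^ 2) (by positivity)
  have hgen : IsLeftGenerating (Fin.snoc a w : Fin (n + 1) → A) := by
    refine isLeftGenerating_of_isUnit (d := Fin.snoc (fun i => star (a i)) (star w)) (hf _ ?_)
    simpa [Fin.sum_univ_castSucc, hx0, map_star] using hw
  obtain ⟨c, hc⟩ := hA _ hgen
  simp only [Fin.snoc_castSucc, Fin.snoc_last] at hc
  -- There is no control on the size of `c`, so `ε` is chosen after it.
  obtain ⟨ε, hε0, hε1, hε⟩ : ∃ ε : ℝ, 0 < ε ∧ ε ≤ 1 ∧ ∀ i, ε * ‖f (c i) * f w‖ < η / 2 := by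
    have hev : ∀ i, ∀ᶠ ε : ℝ in 𝓝[>] 0, ε * ‖f (c i) * f w‖ < η / 2 := fun i => by
      have : Filter.Tendsto (fun ε : ℝ => ε * ‖f (c i) * f w‖) (𝓝 0) (𝓝 (0 * ‖f (c i) * f w‖)) :=
        Filter.Tendsto.mul_const _ Filter.tendsto_id
      rw [zero_mul] at this
      exact (this.mono_left nhdsWithin_le_nhds).eventually (gt_mem_nhds (by positivity))
    obtain ⟨ε, h1, h2⟩ := ((Filter.eventually_all.2 hev).and
      (Ioc_mem_nhdsGT (zero_lt_one (α := ℝ)))).exists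
    exact ⟨ε, h2.1, h2.2, h1⟩
  refine ⟨_, (hc.map f).mul_isUnit (isUnit_smul_one_add_smul hk hε0 hε1), ?_⟩
  rw [dist_pi_lt_iff hη]
  intro i
  -- By the C⋆-identity the square of the left side is at most `‖(1 - k) x (1 - k)‖`, whence the
  -- tolerance `(η / 2) ^ 2`.
  have hak : ‖f (a i) * (1 - k)‖ ≤ η / 2 := by
    refine abs_le_of_sq_le_sq' ?_ (by positivity) |>.2
    have hk' : star (1 - k) = 1 - k := by simp [(IsSelfAdjoint.of_nonneg hk).star_eq]
    rw [sq, ← CStarRing.norm_star_mul_self]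
    refine le_trans ?_ hxk
    refine CStarAlgebra.norm_le_norm_of_nonneg_of_le (star_mul_self_nonneg _) ?_
    have hle : star (f (a i)) * f (a i) ≤ f x := by
      rw [hx0]
      exact Finset.single_le_sum (f := fun i => star (f (a i)) * f (a i))
        (fun i _ => star_mul_self_nonneg _) (Finset.mem_univ i)
    have := star_left_conjugate_le_conjugate hle (1 - k)
    rw [hk'] at this
    simpa only [star_mul, hk', mul_assoc] using this
  have hdiff : f (a i) - f (a i + c i * w) * (ε • (1 : B) + (1 - ε) • k)
      = (1 - ε) • (f (a i) * (1 - k)) - ε • (f (c i) * f w) := by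
    have : f (c i) * f w * k = 0 := by rw [mul_assoc, hyk, mul_zero]
    simp only [map_add, map_mul, mul_add, add_mul, mul_sub, mul_smul_comm, mul_one, this]
    module
  rw [dist_eq_norm, Pi.map_apply, hdiff]
  calc _ ≤ ‖(1 - ε) • (f (a i) * (1 - k))‖ + ‖ε • (f (c i) * f w)‖ := norm_sub_le _ _
    _ < η / 2 + η / 2 := by
      refine add_lt_add_of_le_of_lt ?_ ?_
      · rw [norm_smul, Real.norm_of_nonneg (by linarith)]
        nlinarith [norm_nonneg (f (a i) * (1 - k))]
      · rw [norm_smul, Real.norm_of_nonneg hε0.le]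
        exact hε i
    _ = η := by ring

theorem bsr_eq_of_hasSpectralCutoffs {A : Type*} [Ring A] [StarRing A] [Algebra ℂ A]
    {f : A →⋆ₐ[ℂ] B} (hd : DenseRange f) (hf : ∀ a, IsUnit (f a) → IsUnit a)
    (hs : HasSpectralCutoffs (Set.range f)) : Bsr A = Bsr B :=
  bsr_congr fun _ => ⟨fun h => bassCondition_of_dense (dense_isLeftGenerating hd hf hs h),
    BassCondition.of_denseRange hd hf⟩

/-! ### Construction of the cut-offs. -/

/-- The continuous function which is `0` on `(-∞, δ]`, is `1` on `[2δ, ∞)`, and is affine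
between. -/
noncomputable def ramp (δ t : ℝ) : ℝ := min 1 (max 0 ((t - δ) / δ))

@[fun_prop]
theorem continuous_ramp (δ : ℝ) : Continuous (ramp δ) := by
  unfold ramp
  fun_prop

theorem ramp_nonneg (δ t : ℝ) : 0 ≤ ramp δ t :=
  le_min zero_le_one (le_max_left _ _)

theorem ramp_eq_zero {δ t : ℝ} (hδ : 0 < δ) (h : t ≤ δ) : ramp δ t = 0 := by
  have : (t - δ) / δ ≤ 0 := div_nonpos_of_nonpos_of_nonneg (by linarith) hδ.le
  simp [ramp, max_eq_left this]

theorem one_sub_ramp_mul_self_mul_le {δ t : ℝ} (hδ : 0 < δ) (ht : 0 ≤ t) :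
    |(1 - ramp δ t) * t * (1 - ramp δ t)| ≤ 2 * δ := by
  have h0 := ramp_nonneg δ t
  have h1 : ramp δ t ≤ 1 := min_le_left _ _
  have h2 : 0 ≤ 1 - ramp δ t := by linarith
  rw [abs_of_nonneg (by positivity)]
  rcases le_total t (2 * δ) with h | h
  · have : (1 - ramp δ t) * (1 - ramp δ t) ≤ 1 := by nlinarith
    nlinarith
  · have : 1 ≤ (t - δ) / δ := by rw [le_div_iff₀ hδ]; linarith
    have : ramp δ t = 1 := min_eq_left (this.trans (le_max_right _ _))
    rw [this]
    linarith

theorem norm_one_sub_cfc_ramp_mul_self_mul_le {x : B} (hx : 0 ≤ x) {δ : ℝ} (hδ : 0 < δ) :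
    ‖(1 - cfc (ramp δ) x) * x * (1 - cfc (ramp δ) x)‖ ≤ 2 * δ := by
  have hsa : IsSelfAdjoint x := .of_nonneg hx
  have h1 : 1 - cfc (ramp δ) x = cfc (fun t => 1 - ramp δ t) x := by
    rw [cfc_sub (fun _ => (1 : ℝ)) (ramp δ) x, cfc_const_one ℝ x]
  have h2 : (1 - cfc (ramp δ) x) * x * (1 - cfc (ramp δ) x)
      = cfc (fun t => (1 - ramp δ t) * t * (1 - ramp δ t)) x := by
    rw [cfc_mul (fun t => (1 - ramp δ t) * t) (fun t => 1 - ramp δ t) x,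
      cfc_mul (fun t => 1 - ramp δ t) (fun t => t) x, cfc_id' ℝ x, h1]
  rw [h2]
  exact norm_cfc_le (by positivity) fun t ht =>
    one_sub_ramp_mul_self_mul_le hδ (spectrum_nonneg_of_nonneg hx ht)

theorem cfc_ramp_nonneg (x : B) (δ : ℝ) : 0 ≤ cfc (ramp δ) x :=
  cfc_nonneg fun t _ => ramp_nonneg δ t

theorem hasSpectralCutoffs_of_smooth {S : StarSubalgebra ℂ B}
    (hS : IsClosedUnderSmoothCalculus S) : HasSpectralCutoffs (S : Set B) := by
  intro x hx hx0 δ hδ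
  have hsa : IsSelfAdjoint x := .of_nonneg hx0
  have hδ' : 0 < δ / 2 := by positivity
  -- `g` is `1` for `t ≤ δ/4` and `0` for `t ≥ δ/2`, where the ramp starts to grow.
  let g : ℝ → ℝ := fun t => Real.smoothTransition (2 - 2 / (δ / 2) * t)
  have hg : ContDiff ℝ ∞ g := Real.smoothTransition.contDiff.comp (by fun_prop)
  have hgc : Continuous g := hg.continuous
  refine ⟨cfc g x, hS x hx hsa g hg, ?_, cfc (ramp (δ / 2)) x, cfc_ramp_nonneg _ _, ?_,
    (norm_one_sub_cfc_ramp_mul_self_mul_le hx0 hδ').trans_eq (by ring)⟩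
  · have : x + star (cfc g x) * cfc g x = cfc (fun t => t + g t * g t) x := by
      rw [cfc_add (a := x) (fun t => t) (fun t => g t * g t), cfc_id' ℝ x, cfc_mul g g x,
        (IsSelfAdjoint.cfc (f := g) (a := x)).star_eq]
    rw [this, isUnit_cfc_iff _ _]
    intro t ht h
    have ht0 : 0 ≤ t := spectrum_nonneg_of_nonneg hx0 ht
    have ht' : t = 0 := by nlinarith [mul_self_nonneg (g t)]
    subst ht'
    have : g 0 = 1 := Real.smoothTransition.one_of_one_le (by norm_num)
    simp [this] at h
  · rw [← cfc_mul g (ramp (δ / 2)) x]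
    have : (fun t => g t * ramp (δ / 2) t) = fun _ => 0 := by
      ext t
      rcases le_total t (δ / 2) with h | h
      · rw [ramp_eq_zero hδ' h, mul_zero]
      · have : g t = 0 := by
          refine Real.smoothTransition.zero_of_nonpos ?_
          have : 1 ≤ t / (δ / 2) := by rwa [one_le_div hδ']
          have e : 2 / (δ / 2) * t = 2 * (t / (δ / 2)) := by ring
          linarith
        rw [this, zero_mul]
    rw [this, cfc_const_zero]

theorem hasSpectralCutoffs_of_isLocallyNormal {C : StarSubalgebra ℂ B}
    (hC : IsLocallyNormal C) : HasSpectralCutoffs (C : Set B) := by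
  intro x hx hx0 δ hδ
  have hsa : IsSelfAdjoint x := .of_nonneg hx0
  have hδ' : 0 < δ / 2 := by positivity
  obtain ⟨E, hxE, hE, hcomm, -, hnormal⟩ := hC x hx hsa
  let _ : CommCStarAlgebra E :=
    { StarSubalgebra.cstarAlgebra E (h_closed := hE) with
      mul_comm := fun a b => Subtype.ext (hcomm a a.2 b b.2) }
  let x' : E := ⟨x, hxE⟩
  have hsa' : IsSelfAdjoint x' := Subtype.ext hsa
  -- Spectral permanence: the spectrum does not change from `E` to `B`.
  have hspec : ∀ r ∈ spectrum ℝ x', 0 ≤ r := fun r hr => by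
    refine spectrum_nonneg_of_nonneg hx0 ?_
    rw [← spectrum.algebraMap_mem_iff ℂ] at hr ⊢
    rwa [StarSubalgebra.spectrum_eq (S := E)] at hr
  have hcont : Continuous fun φ : WeakDual.characterSpace ℂ E => (φ x').re :=
    Complex.continuous_re.comp ((WeakDual.eval_continuous x').comp continuous_subtype_val)
  -- A character killing `x + y⋆y` would kill both `x` and `y`, but `y` is `1` where `x` vanishes.
  -- The ramp of `x` lives where `y` is `0`.
  obtain ⟨y, hyC, hy0, hy1⟩ := hnormal {φ | δ / 2 ≤ (φ x').re} {φ | (φ x').re ≤ 0}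
    (isClosed_le continuous_const hcont) (isClosed_le hcont continuous_const)
    (Set.disjoint_left.2 fun φ (h : δ / 2 ≤ (φ x').re) (h' : (φ x').re ≤ 0) => by linarith)
  have hcfc : ((cfc (ramp (δ / 2)) x' : E) : B) = cfc (ramp (δ / 2)) x :=
    StarAlgHom.map_cfc E.subtype (ramp (δ / 2)) x' (hφ := continuous_subtype_val)
  refine ⟨y, hyC, ?_, cfc (ramp (δ / 2)) x, cfc_ramp_nonneg _ _, ?_,
    (norm_one_sub_cfc_ramp_mul_self_mul_le hx0 hδ').trans_eq (by ring)⟩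
  · suffices h : IsUnit (x' + star y * y) from h.map E.subtype
    by_contra h
    obtain ⟨φ, hφ⟩ := WeakDual.CharacterSpace.exists_apply_eq_zero h
    obtain ⟨r, hr, hrs, -⟩ := exists_character_real hsa' φ
    have hr0 := hspec r hrs
    rw [map_add, map_mul, map_star, hr, Complex.star_def, Complex.conj_mul', ← Complex.ofReal_pow,
      ← Complex.ofReal_add, Complex.ofReal_eq_zero] at hφ
    have : φ y = 1 := hy1 φ (show (φ x').re ≤ 0 by
      rw [hr, Complex.ofReal_re]
      nlinarith [sq_nonneg ‖φ y‖])
    rw [this, norm_one] at hφ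
    linarith
  · suffices h : y * cfc (ramp (δ / 2)) x' = 0 by
      rw [← hcfc]
      exact congrArg Subtype.val h
    refine (gelfandTransform_isometry E).injective ?_
    ext φ
    obtain ⟨r, hr, -, hrk⟩ := exists_character_real hsa' φ
    suffices h : φ y * φ (cfc (ramp (δ / 2)) x') = 0 by
      simpa using h
    rcases le_total r (δ / 2) with h | h
    · rw [hrk _ (continuous_ramp _), ramp_eq_zero hδ' h, Complex.ofReal_zero, mul_zero]
    · rw [hy0 φ (show δ / 2 ≤ (φ x').re by rwa [hr]), zero_mul]

end CStar

theorem theorem4p9 {B : Type*} [CStarAlgebra B] :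
    (∀ (A : Type*) [Ring A] [StarRing A] [Algebra ℂ A] [StarModule ℂ A] (t : TopologicalSpace A)
        (f : A →⋆ₐ[ℂ] B),
        IsFrechetQAlgebra A t →
        DenseRange f →
        (∀ a : A, IsUnit (f a) → IsUnit a) →
        IsLocallyNormal f.range →
        Bsr A = Bsr B) ∧
    (∀ (S : StarSubalgebra ℂ B) (t : TopologicalSpace S),
        IsFrechetQAlgebra S t →
        Dense (S : Set B) →
        (∀ a : S, IsUnit (a : B) → IsUnit a) →
        IsClosedUnderSmoothCalculus S →
        Bsr S = Bsr B) := by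
  let _ := CStarAlgebra.spectralOrder B
  have _ := CStarAlgebra.spectralOrderedRing B
  refine ⟨fun A _ _ _ _ _ f _ hd hf hloc => ?_, fun S _ _ hd hf hsm => ?_⟩
  · refine bsr_eq_of_hasSpectralCutoffs hd hf ?_
    exact hasSpectralCutoffs_of_isLocallyNormal hloc
  · refine bsr_eq_of_hasSpectralCutoffs (f := S.subtype) hd.denseRange_val hf ?_
    have : Set.range S.subtype = S := Subtype.range_coe
    rw [this]
    exact hasSpectralCutoffs_of_smooth hsm
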